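/- Let $S^2\subset\mathbb{R}^3$ be the unit sphere with its standard smooth structure and orientation, and let $\mathrm{Diff}^1(S^2)$ be the group of orientation-preserving diffeomorphisms of class $C^1$ of $S^2$. Let $\mathrm{Rot}(S^2)$ be the group of rotations of $S^2$, that is, of the transformations $p\mapsto Ap$ with $A\in SO(3)$, and let $\mathrm{M\ddot{o}b}(S^2)$ be the group of the transformations of $S^2$ that correspond, under stereographic projection $S^2\cong\mathbb{C}\cup\{\infty\}$ from the north pole, to the maps $z\mapsto\frac{az+b}{cz+d}$ with $a,b,c,d\in\mathbb{C}$ and $ad-bc=1$. A group $G$ of transformations of $S^2$ is called sharply $3$-transitive if for any two triples $(p_1,p_2,p_3)$ and $(q_1,q_2,q_3)$, each consisting of mutually distinct points of $S^2$, there is $g\in G$ with $g(p_i)=q_i$ for $i=1,2,3$, and if moreover, for every triple of mutually distinct points of $S^2$, the identity is the only element of $G$ that fixes all three of them. Let $G$ be a subgroup of $\mathrm{Diff}^1(S^2)$ with $\mathrm{Rot}(S^2)\subseteq G$. If $G$ is sharply $3$-transitive, then $G=\mathrm{M\ddot{o}b}(S^2)$. -/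

import Mathlib

open scoped Manifold ContDiff MatrixGroups

noncomputable section

namespace SharpMobius

/-- Euclidean three-space. -/
abbrev E3 : Type := EuclideanSpace ℝ (Fin 3)

/-- The unit sphere of Euclidean three-space, with Mathlib's standard smooth structure. -/
abbrev S2 : Type := Metric.sphere (0 : E3) 1

/-- The standard volume form of three-space. -/
def vol (a b c : E3) : ℝ := Matrix.det (Matrix.of ![a.ofLp, b.ofLp, c.ofLp])

/-- The differential at `p` of a map `f` from the sphere to itself, with values regarded as vectors
of the ambient three-space. The case of the identity map is the inclusion of the tangent plane. -/
def ambientDeriv (f : S2 → S2) (p : S2) : TangentSpace (𝓡 2) p →L[ℝ] E3 :=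
  mfderiv (𝓡 2) 𝓘(ℝ, E3) (fun x : S2 => (f x : E3)) p

/-- The differential of `f` at every point `p` sends positive frames of the tangent plane at `p` to
positive frames of the tangent plane at `f p`. The frame `(u, v)` is positive at `p` when
`(p, u, v)` is a positive frame of three-space. -/
def PreservesOrientation (f : S2 → S2) : Prop :=
  ∀ (p : S2) (u v : TangentSpace (𝓡 2) p),
    0 < vol (p : E3) (ambientDeriv id p u) (ambientDeriv id p v) →
      0 < vol (f p : E3) (ambientDeriv f p u) (ambientDeriv f p v)

/-- The orientation preserving diffeomorphisms of class `C¹` of the sphere. -/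
def DiffOne : Set (Equiv.Perm S2) :=
  {f | ContMDiff (𝓡 2) (𝓡 2) 1 f ∧ ContMDiff (𝓡 2) (𝓡 2) 1 f.symm ∧ PreservesOrientation f}

/-- The rotations of the sphere: the transformations induced by the matrices of `SO(3)`. -/
def Rot : Set (Equiv.Perm S2) :=
  {f | ∃ A ∈ Matrix.specialOrthogonalGroup (Fin 3) ℝ,
    ∀ p : S2, (f p : E3).ofLp = Matrix.mulVec A (p : E3).ofLp}

lemma coord_sq (p : S2) : (p : E3) 0 ^ 2 + (p : E3) 1 ^ 2 + (p : E3) 2 ^ 2 = 1 := by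
  have h : ‖(p : E3)‖ = 1 := by simp
  have h2 := EuclideanSpace.real_norm_sq_eq (p : E3)
  rw [h, Fin.sum_univ_three] at h2
  linarith

/-- Stereographic projection from the north pole `(0, 0, 1)`, which goes to the point at infinity:
`(x, y, z)` is sent to `(x + i y) / (1 - z)`. -/
def stereoFun (p : S2) : OnePoint ℂ :=
  open Classical in
  if (p : E3) 2 = 1 then OnePoint.infty
  else (((⟨(p : E3) 0 / (1 - (p : E3) 2), (p : E3) 1 / (1 - (p : E3) 2)⟩ : ℂ)) : OnePoint ℂ)

/-- The inverse of stereographic projection. -/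
def stereoInv : OnePoint ℂ → S2
  | OnePoint.infty => ⟨!₂[0, 0, 1], by simp [EuclideanSpace.norm_eq, Fin.sum_univ_three]⟩
  | OnePoint.some w =>
      ⟨!₂[2 * w.re / (w.re ^ 2 + w.im ^ 2 + 1), 2 * w.im / (w.re ^ 2 + w.im ^ 2 + 1),
          (w.re ^ 2 + w.im ^ 2 - 1) / (w.re ^ 2 + w.im ^ 2 + 1)], by
        have h : w.re ^ 2 + w.im ^ 2 + 1 ≠ 0 := by positivity
        rw [mem_sphere_zero_iff_norm, EuclideanSpace.norm_eq, Real.sqrt_eq_one]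
        simp only [Fin.sum_univ_three, Real.norm_eq_abs, sq_abs]
        simp
        field_simp
        ring⟩

/-- Stereographic projection as an identification of the sphere with the extended plane. -/
def stereo : S2 ≃ OnePoint ℂ where
  toFun := stereoFun
  invFun := stereoInv
  left_inv p := by
    have hp := coord_sq p
    by_cases h : (p : E3) 2 = 1
    · have h0 : (p : E3) 0 = 0 := by nlinarith [sq_nonneg ((p : E3) 0), sq_nonneg ((p : E3) 1)]
      have h1 : (p : E3) 1 = 0 := by nlinarith [sq_nonneg ((p : E3) 0), sq_nonneg ((p : E3) 1)]
      rw [stereoFun, if_pos h]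
      ext i
      fin_cases i <;> simp [stereoInv, h, h0, h1]
    · have h' : 1 - (p : E3) 2 ≠ 0 := fun e => h (by linarith)
      rw [stereoFun, if_neg h]
      have key : ((p : E3) 0 / (1 - (p : E3) 2)) ^ 2 + ((p : E3) 1 / (1 - (p : E3) 2)) ^ 2 + 1
          = 2 / (1 - (p : E3) 2) := by
        field_simp
        linarith
      have key2 : ((p : E3) 0 / (1 - (p : E3) 2)) ^ 2 + ((p : E3) 1 / (1 - (p : E3) 2)) ^ 2 - 1
          = 2 / (1 - (p : E3) 2) - 2 := by linarith
      ext i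
      fin_cases i
      · simp only [stereoInv, key, key2]
        simp
        field_simp
      · simp only [stereoInv, key, key2]
        simp
        field_simp
      · simp only [stereoInv, key, key2]
        simp
        field_simp
        ring
  right_inv w := by
    induction w using OnePoint.rec with
    | infty => simp [stereoInv, stereoFun]
    | coe w =>
      have h : w.re ^ 2 + w.im ^ 2 + 1 ≠ 0 := by positivity
      have h1 : (w.re ^ 2 + w.im ^ 2 - 1) / (w.re ^ 2 + w.im ^ 2 + 1) ≠ 1 := by
        rw [Ne, div_eq_one_iff_eq h]
        intro e
        linarith
      have h2 : 1 - (w.re ^ 2 + w.im ^ 2 - 1) / (w.re ^ 2 + w.im ^ 2 + 1)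
          = 2 / (w.re ^ 2 + w.im ^ 2 + 1) := by
        field_simp
        ring
      change stereoFun (stereoInv (OnePoint.some w)) = _
      have e2 : ((stereoInv (OnePoint.some w) : S2) : E3) 2
          = (w.re ^ 2 + w.im ^ 2 - 1) / (w.re ^ 2 + w.im ^ 2 + 1) := by simp [stereoInv]
      have e0 : ((stereoInv (OnePoint.some w) : S2) : E3) 0
          = 2 * w.re / (w.re ^ 2 + w.im ^ 2 + 1) := by simp [stereoInv]
      have e1 : ((stereoInv (OnePoint.some w) : S2) : E3) 1
          = 2 * w.im / (w.re ^ 2 + w.im ^ 2 + 1) := by simp [stereoInv]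
      rw [stereoFun, e2, if_neg h1, e0, e1, h2]
      congr 1
      apply Complex.ext
      · simp only []
        field_simp
      · simp only []
        field_simp

/-- The Möbius transformation `z ↦ (a z + b) / (c z + d)` of the extended plane, carried over to the
sphere by stereographic projection, as a homomorphism from `SL(2, ℂ)`. -/
def mobius : SL(2, ℂ) →* Equiv.Perm S2 :=
  (stereo.symm.permCongrHom.toMonoidHom.comp
    (MulAction.toPermHom (GL (Fin 2) ℂ) (OnePoint ℂ))).comp Matrix.SpecialLinearGroup.toGL

/-- The Möbius group of the sphere. -/
def Mob : Subgroup (Equiv.Perm S2) := mobius.range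

/-- A group of transformations of `X` is sharply `k`-transitive when it is transitive on the
`k`-tuples of distinct points and only the identity fixes every point of such a tuple. -/
def SharplyTransitive {X : Type*} (k : ℕ) (G : Subgroup (Equiv.Perm X)) : Prop :=
  MulAction.IsMultiplyPretransitive G X k ∧
    ∀ p : Fin k ↪ X, ∀ g ∈ G, (∀ i, g (p i) = p i) → g = 1

end SharpMobius

end

noncomputable section

namespace SharpMobius

open OnePoint Filter Topology
open scoped ComplexConjugate

/-! Work in the stereographic coordinate, with the poles at `0` and `∞`. The crux is that every `h ∈
G` fixing both poles has the form `z ↦ c z`.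

Rotations about the axis: for a unit `c`, the map `h` conjugates `z ↦ c z` to some `k ∈ G` fixing
the poles. On the unit circle `|h (c w)| - |h w|` is `≤ 0` where `|h|` is maximal and `≥ 0` where it
is minimal, so it vanishes somewhere. There `k` agrees with an axial rotation, and sharpness makes
`k` equal to it: `h (c w) = d h w` (`exists_planeMap_mul_eq`). The differential at `0` and
orientation force `d = c` and complex linearity (`fderiv_planeMap_zero_I`).

Holomorphy: transitivity reduces conformality at `0` of any `g ∈ G` fixing `0` to the case where `∞`
is fixed too (`fderiv_planeMap_I`); rotations carry this to every point. A holomorphic map commuting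
with rotations is linear (`eq_mul_of_commutes_rotations`).

Conclusion: transitivity now puts all dilations in `G`. With `SU(2)` they generate `SL(2, ℂ)`, so
`G` contains the Möbius group; correcting `g ∈ G` by Möbius maps until it fixes the poles gives the
other inclusion. -/

/-! ### Coordinates on the sphere -/

/-- The north pole, which is the point at infinity of the extended plane. -/
def north : S2 := stereo.symm ∞

/-- The point of the sphere with a given stereographic coordinate. -/
def ofPlane (w : ℂ) : S2 := stereo.symm (w : OnePoint ℂ)

/-- The ambient extension of the stereographic coordinate. -/
def ambientCoord (x : E3) : ℂ := ((1 - x 2)⁻¹ : ℝ) • ((x 0 : ℂ) + (x 1 : ℂ) * Complex.I)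

/-- The stereographic coordinate, with the value `0` at the north pole. -/
def toPlane (p : S2) : ℂ := ambientCoord (p : E3)

lemma ofPlane_ne_north (w : ℂ) : ofPlane w ≠ north := fun h =>
  OnePoint.coe_ne_infty w (stereo.symm.injective h)

lemma ofPlane_injective : Function.Injective ofPlane := fun _ _ h =>
  OnePoint.coe_injective (stereo.symm.injective h)

lemma eq_north_or_ofPlane (p : S2) : p = north ∨ ∃ w, p = ofPlane w := by
  induction h : stereo p using OnePoint.rec with
  | infty => exact Or.inl (by rw [north, ← h, Equiv.symm_apply_apply])
  | coe w => exact Or.inr ⟨w, by rw [ofPlane, ← h, Equiv.symm_apply_apply]⟩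

lemma ofPlane_coe (w : ℂ) : (ofPlane w : E3) =
    !₂[2 * w.re / (w.re ^ 2 + w.im ^ 2 + 1), 2 * w.im / (w.re ^ 2 + w.im ^ 2 + 1),
      (w.re ^ 2 + w.im ^ 2 - 1) / (w.re ^ 2 + w.im ^ 2 + 1)] := rfl

lemma north_coe : (north : E3) = !₂[0, 0, 1] := rfl

lemma ambientCoord_re (x : E3) : (ambientCoord x).re = (1 - x 2)⁻¹ * x 0 := by
  simp only [ambientCoord, Complex.real_smul, Complex.re_ofReal_mul]
  simp

lemma ambientCoord_im (x : E3) : (ambientCoord x).im = (1 - x 2)⁻¹ * x 1 := by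
  simp only [ambientCoord, Complex.real_smul, Complex.im_ofReal_mul]
  simp

@[simp] lemma toPlane_ofPlane (w : ℂ) : toPlane (ofPlane w) = w := by
  have h : w.re ^ 2 + w.im ^ 2 + 1 ≠ 0 := by positivity
  have h2 : 1 - (w.re ^ 2 + w.im ^ 2 - 1) / (w.re ^ 2 + w.im ^ 2 + 1)
      = 2 / (w.re ^ 2 + w.im ^ 2 + 1) := by
    field_simp
    ring
  rw [toPlane, ofPlane_coe]
  apply Complex.ext
  · rw [ambientCoord_re]
    change (1 - (w.re ^ 2 + w.im ^ 2 - 1) / (w.re ^ 2 + w.im ^ 2 + 1))⁻¹ *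
      (2 * w.re / (w.re ^ 2 + w.im ^ 2 + 1)) = w.re
    rw [h2]
    field_simp
  · rw [ambientCoord_im]
    change (1 - (w.re ^ 2 + w.im ^ 2 - 1) / (w.re ^ 2 + w.im ^ 2 + 1))⁻¹ *
      (2 * w.im / (w.re ^ 2 + w.im ^ 2 + 1)) = w.im
    rw [h2]
    field_simp

lemma ofPlane_toPlane {p : S2} (hp : p ≠ north) : ofPlane (toPlane p) = p := by
  obtain rfl | ⟨w, rfl⟩ := eq_north_or_ofPlane p
  · exact absurd rfl hp
  · rw [toPlane_ofPlane]

lemma coord_two_ne_one {p : S2} (hp : p ≠ north) : (p : E3) 2 ≠ 1 := by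
  obtain rfl | ⟨w, rfl⟩ := eq_north_or_ofPlane p
  · exact absurd rfl hp
  · have h : w.re ^ 2 + w.im ^ 2 + 1 ≠ 0 := by positivity
    rw [ofPlane_coe]
    change (w.re ^ 2 + w.im ^ 2 - 1) / (w.re ^ 2 + w.im ^ 2 + 1) ≠ 1
    rw [Ne, div_eq_one_iff_eq h]
    intro e
    linarith

lemma mobius_ofPlane (A : SL(2, ℂ)) (w : ℂ) : mobius A (ofPlane w) =
    if A 1 0 * w + A 1 1 = 0 then north
    else ofPlane ((A 0 0 * w + A 0 1) / (A 1 0 * w + A 1 1)) := by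
  have h : mobius A (ofPlane w)
      = stereo.symm (Matrix.SpecialLinearGroup.toGL A • (w : OnePoint ℂ)) := by
    change stereo.symm (Matrix.SpecialLinearGroup.toGL A • stereo (stereo.symm _)) = _
    rw [Equiv.apply_symm_apply]
  rw [h, OnePoint.smul_some_eq_ite]
  by_cases hc : A 1 0 * w + A 1 1 = 0 <;> simp [hc] <;> rfl

lemma mobius_north (A : SL(2, ℂ)) : mobius A north =
    if A 1 0 = 0 then north else ofPlane (A 0 0 / A 1 0) := by
  have h : mobius A north = stereo.symm (Matrix.SpecialLinearGroup.toGL A • (∞ : OnePoint ℂ)) := by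
    change stereo.symm (Matrix.SpecialLinearGroup.toGL A • stereo (stereo.symm _)) = _
    rw [Equiv.apply_symm_apply]
  rw [h, OnePoint.smul_infty_eq_ite]
  by_cases hc : A 1 0 = 0 <;> simp [hc] <;> rfl

/-! ### Some elements of `SL(2, ℂ)` -/

/-- The diagonal matrix with entries `x` and `x⁻¹`, which acts as `z ↦ x² z`. -/
def dilation (x : ℂ) (hx : x ≠ 0) : SL(2, ℂ) :=
  ⟨!![x, 0; 0, x⁻¹], by simp [Matrix.det_fin_two, hx]⟩

/-- The upper unipotent matrix which acts as `z ↦ z + b`. -/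
def translation (b : ℂ) : SL(2, ℂ) := ⟨!![1, b; 0, 1], by simp [Matrix.det_fin_two]⟩

/-- The matrix of `SU(2)` with first row `(a, b)`. -/
def unitaryMatrix (a b : ℂ) (h : a * conj a + b * conj b = 1) : SL(2, ℂ) :=
  ⟨!![a, b; -conj b, conj a], by rw [Matrix.det_fin_two]; simpa using h⟩

lemma coe_dilation (x : ℂ) (hx : x ≠ 0) :
    (dilation x hx : Matrix (Fin 2) (Fin 2) ℂ) = !![x, 0; 0, x⁻¹] := rfl

lemma coe_translation (b : ℂ) :
    (translation b : Matrix (Fin 2) (Fin 2) ℂ) = !![1, b; 0, 1] := rfl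

lemma coe_unitaryMatrix (a b : ℂ) (h : a * conj a + b * conj b = 1) :
    (unitaryMatrix a b h : Matrix (Fin 2) (Fin 2) ℂ) = !![a, b; -conj b, conj a] := rfl

lemma mobius_dilation_ofPlane (x : ℂ) (hx : x ≠ 0) (w : ℂ) :
    mobius (dilation x hx) (ofPlane w) = ofPlane (x ^ 2 * w) := by
  rw [mobius_ofPlane]
  simp [dilation, hx]
  congr 1
  ring

lemma mobius_dilation_north (x : ℂ) (hx : x ≠ 0) : mobius (dilation x hx) north = north := by
  rw [mobius_north]
  simp [dilation]

lemma mobius_translation_ofPlane (b w : ℂ) :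
    mobius (translation b) (ofPlane w) = ofPlane (w + b) := by
  rw [mobius_ofPlane]
  simp [translation]

lemma mobius_translation_north (b : ℂ) : mobius (translation b) north = north := by
  rw [mobius_north]
  simp [translation]

/-! ### `SU(2)` acts by rotations. -/

/-- The rotation of three-space induced by the matrix of `SU(2)` with first row `(a, b)`. -/
def rotationMatrix (a b : ℂ) : Matrix (Fin 3) (Fin 3) ℝ :=
  !![(a ^ 2 - b ^ 2).re, -(a ^ 2 + b ^ 2).im, -2 * (a * b).re;
     (a ^ 2 - b ^ 2).im, (a ^ 2 + b ^ 2).re, -2 * (a * b).im;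
     2 * (a * conj b).re, -2 * (a * conj b).im, Complex.normSq a - Complex.normSq b]

lemma rotationMatrix_mem {a b : ℂ} (h : a * conj a + b * conj b = 1) :
    rotationMatrix a b ∈ Matrix.specialOrthogonalGroup (Fin 3) ℝ := by
  have e : a.re ^ 2 + a.im ^ 2 + b.re ^ 2 + b.im ^ 2 = 1 := by
    have := congrArg Complex.re h
    simp at this
    linarith
  rw [Matrix.mem_specialOrthogonalGroup_iff, Matrix.mem_orthogonalGroup_iff]
  obtain ⟨p, q⟩ := a
  obtain ⟨r, s⟩ := b
  simp only at e
  have e2 : (p ^ 2 + q ^ 2 + r ^ 2 + s ^ 2) ^ 2 = 1 := by rw [e]; norm_num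
  -- The entries are quadratic in `p, q, r, s`: the diagonal of the product with the transpose is
  -- the square of the norm form, and the determinant is its cube.
  have e3 : (p ^ 2 + q ^ 2 + r ^ 2 + s ^ 2) ^ 3 = 1 := by rw [e]; norm_num
  constructor
  · ext i j
    fin_cases i <;> fin_cases j <;>
      simp [rotationMatrix, Matrix.mul_apply, Fin.sum_univ_three, pow_two, Complex.normSq_apply]
    all_goals first | ring1 | linear_combination e2
  · rw [Matrix.det_fin_three]
    simp [rotationMatrix, pow_two, Complex.normSq_apply]
    linear_combination e3

/-- Inverse stereographic projection in homogeneous coordinates `[z : w]`: one formula covers both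
the plane and the point at infinity, so Möbius images need no separate case. -/
lemma coe_of_homogeneous {z w : ℂ} (h : w = 0 → z ≠ 0) :
    ((if w = 0 then north else ofPlane (z / w) : S2) : E3) =
      !₂[2 * (z * conj w).re / (Complex.normSq z + Complex.normSq w),
        2 * (z * conj w).im / (Complex.normSq z + Complex.normSq w),
        (Complex.normSq z - Complex.normSq w) / (Complex.normSq z + Complex.normSq w)] := by
  by_cases hw : w = 0
  · have hz : Complex.normSq z ≠ 0 := by simpa using h hw
    subst hw
    rw [if_pos rfl, north_coe]
    simp [hz]
  · have hw' : Complex.normSq w ≠ 0 := by simpa using hw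
    have hw2 : Complex.normSq z + Complex.normSq w ≠ 0 :=
      (add_pos_of_nonneg_of_pos (Complex.normSq_nonneg _) (Complex.normSq_pos.2 hw)).ne'
    have hn : (z / w).re ^ 2 + (z / w).im ^ 2 = Complex.normSq z / Complex.normSq w := by
      rw [← Complex.normSq_div, Complex.normSq_apply]; ring
    have h3 : (z / w).re = (z * conj w).re / Complex.normSq w := by
      rw [Complex.div_re]; simp; ring
    have h4 : (z / w).im = (z * conj w).im / Complex.normSq w := by
      rw [Complex.div_im]; simp; ring
    rw [if_neg hw, ofPlane_coe, hn, h3, h4]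
    congr 1
    ext i
    fin_cases i <;> simp <;> field_simp

lemma mobius_unitaryMatrix_mem_Rot {a b : ℂ} (h : a * conj a + b * conj b = 1) :
    mobius (unitaryMatrix a b h) ∈ Rot := by
  refine ⟨rotationMatrix a b, rotationMatrix_mem h, fun p => ?_⟩
  have e : Complex.normSq a + Complex.normSq b = 1 := by
    have := congrArg Complex.re h
    rw [Complex.mul_conj, Complex.mul_conj] at this
    simpa using this
  obtain rfl | ⟨w, rfl⟩ := eq_north_or_ofPlane p
  · rw [mobius_north]
    change WithLp.ofLp ((if -conj b = 0 then north else ofPlane (a / -conj b) : S2) : E3) = _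
    have e' : Complex.normSq a + Complex.normSq (-conj b) = 1 := by simpa using e
    rw [coe_of_homogeneous, e', north_coe]
    · ext i
      fin_cases i <;> simp [rotationMatrix, Matrix.mulVec, dotProduct, Fin.sum_univ_three] <;> ring
    · rintro hb rfl
      simp_all
  · rw [mobius_ofPlane]
    change WithLp.ofLp ((if -conj b * w + conj a = 0 then north
      else ofPlane ((a * w + b) / (-conj b * w + conj a)) : S2) : E3) = _
    -- A unitary matrix preserves the Hermitian norm of `(w, 1)`, so the denominators before and
    -- after agree and only the numerators remain to be compared.
    have e' : Complex.normSq (a * w + b) + Complex.normSq (-conj b * w + conj a)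
        = w.re ^ 2 + w.im ^ 2 + 1 := by
      simp only [Complex.normSq_apply] at e ⊢
      simp
      linear_combination (w.re ^ 2 + w.im ^ 2 + 1) * e
    have hw : w.re ^ 2 + w.im ^ 2 + 1 ≠ 0 := by positivity
    rw [coe_of_homogeneous, e', ofPlane_coe]
    · ext i
      fin_cases i <;> simp [rotationMatrix, Matrix.mulVec, dotProduct, Fin.sum_univ_three,
        Complex.normSq_apply, pow_two] <;> field_simp <;> ring
    · intro h0 h1
      simp only [h0, h1, map_zero, add_zero] at e'
      exact hw e'.symm


/-! ### Differentiability in the stereographic coordinate -/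

/-- A transformation of the sphere, read in the stereographic coordinate. -/
def planeMap (g : Equiv.Perm S2) (w : ℂ) : ℂ := toPlane (g (ofPlane w))

lemma ofPlane_planeMap {g : Equiv.Perm S2} {w : ℂ} (h : g (ofPlane w) ≠ north) :
    ofPlane (planeMap g w) = g (ofPlane w) := ofPlane_toPlane h

/-- Only the inner map has to avoid the north pole: if the outer one hits it, both sides take the
default value `0`. -/
lemma planeMap_mul {g h : Equiv.Perm S2} {w : ℂ} (hw : h (ofPlane w) ≠ north) :
    planeMap (g * h) w = planeMap g (planeMap h w) := by
  rw [planeMap, planeMap, ofPlane_planeMap hw, Equiv.Perm.mul_apply]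

lemma contDiff_coe_ofPlane : ContDiff ℝ 1 (fun w : ℂ => (ofPlane w : E3)) := by
  have hre : ContDiff ℝ 1 Complex.re := Complex.reCLM.contDiff
  have him : ContDiff ℝ 1 Complex.im := Complex.imCLM.contDiff
  have h (w : ℂ) : w.re ^ 2 + w.im ^ 2 + 1 ≠ 0 := by positivity
  rw [contDiff_euclidean]
  intro i
  simp only [ofPlane_coe]
  fin_cases i
  · exact (contDiff_const.mul hre).div (((hre.pow 2).add (him.pow 2)).add contDiff_const) h
  · exact (contDiff_const.mul him).div (((hre.pow 2).add (him.pow 2)).add contDiff_const) h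
  · exact (((hre.pow 2).add (him.pow 2)).sub contDiff_const).div
      (((hre.pow 2).add (him.pow 2)).add contDiff_const) h

lemma fact_finrank : Fact (Module.finrank ℝ E3 = 2 + 1) := ⟨by simp⟩

lemma contMDiff_ofPlane : ContMDiff 𝓘(ℝ, ℂ) (𝓡 2) 1 ofPlane :=
  haveI := fact_finrank
  ContMDiff.codRestrict_sphere (n := 2) contDiff_coe_ofPlane.contMDiff (fun w => (ofPlane w).2)

lemma contMDiff_coe {g : Equiv.Perm S2} (hg : g ∈ DiffOne) :
    ContMDiff (𝓡 2) 𝓘(ℝ, E3) 1 (fun p => (g p : E3)) :=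
  haveI := fact_finrank
  (contMDiff_coe_sphere (m := 1) (n := 2)).comp hg.1

lemma differentiable_coe_ofPlane {g : Equiv.Perm S2} (hg : g ∈ DiffOne) :
    Differentiable ℝ (fun w => (g (ofPlane w) : E3)) := by
  have h : ContMDiff 𝓘(ℝ, ℂ) 𝓘(ℝ, E3) 1 (fun w => (g (ofPlane w) : E3)) :=
    (contMDiff_coe hg).comp contMDiff_ofPlane
  exact (contMDiff_iff_contDiff.1 h).differentiable one_ne_zero

lemma eventually_ne_north {g : Equiv.Perm S2} (hg : g ∈ DiffOne) {w : ℂ}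
    (hw : g (ofPlane w) ≠ north) : ∀ᶠ z in 𝓝 w, g (ofPlane z) ≠ north := by
  have hc : Continuous fun z => g (ofPlane z) := hg.1.continuous.comp contMDiff_ofPlane.continuous
  exact hc.continuousAt.eventually_ne hw

lemma differentiableAt_ambientCoord {x : E3} (hx : x 2 ≠ 1) :
    DifferentiableAt ℝ ambientCoord x := by
  have h (i : Fin 3) : DifferentiableAt ℝ (fun y : E3 => y i) x :=
    (EuclideanSpace.proj (𝕜 := ℝ) i).differentiableAt
  have hC (i : Fin 3) : DifferentiableAt ℝ (fun y : E3 => ((y i : ℝ) : ℂ)) x :=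
    Complex.ofRealCLM.differentiableAt.comp x (h i)
  have h1 : 1 - x 2 ≠ 0 := fun e => hx (by linarith)
  exact (((differentiableAt_const _).sub (h 2)).inv h1).smul
    ((hC 0).add ((hC 1).mul (differentiableAt_const _)))

lemma differentiableAt_planeMap {g : Equiv.Perm S2} (hg : g ∈ DiffOne) {w : ℂ}
    (hw : g (ofPlane w) ≠ north) : DifferentiableAt ℝ (planeMap g) w :=
  (differentiableAt_ambientCoord (coord_two_ne_one hw)).comp (f := fun w => (g (ofPlane w) : E3)) w
    (differentiable_coe_ofPlane hg w)

lemma planeMap_mul_eventuallyEq {g h : Equiv.Perm S2} (hh : h ∈ DiffOne) {w : ℂ}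
    (hw : h (ofPlane w) ≠ north) : planeMap (g * h) =ᶠ[𝓝 w] planeMap g ∘ planeMap h := by
  filter_upwards [eventually_ne_north hh hw] with z hz using planeMap_mul hz

/-! ### Orientation in the stereographic coordinate. -/

lemma ambientDeriv_mfderiv {g : Equiv.Perm S2} (hg : g ∈ DiffOne) (w a : ℂ) :
    ambientDeriv g (ofPlane w) (mfderiv 𝓘(ℝ, ℂ) (𝓡 2) ofPlane w a)
      = fderiv ℝ (fun w => (g (ofPlane w) : E3)) w a := by
  have h := mfderiv_comp (I := 𝓘(ℝ, ℂ)) (I' := 𝓡 2) (I'' := 𝓘(ℝ, E3)) (f := ofPlane) w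
    ((contMDiff_coe hg).mdifferentiableAt (x := ofPlane w) one_ne_zero)
    (contMDiff_ofPlane.mdifferentiableAt one_ne_zero)
  rw [← mfderiv_eq_fderiv]
  exact (congrArg (fun L => L a) h).symm

lemma one_mem_DiffOne : (1 : Equiv.Perm S2) ∈ DiffOne :=
  ⟨contMDiff_id, contMDiff_id, fun _ _ _ h => h⟩

lemma hasFDerivAt_coe_ofPlane_zero : HasFDerivAt (fun w : ℂ => (ofPlane w : E3))
    (fderiv ℝ (fun w : ℂ => (ofPlane w : E3)) 0) 0 :=
  (contDiff_coe_ofPlane.differentiable one_ne_zero 0).hasFDerivAt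

lemma fderiv_coe_ofPlane_zero (a : ℂ) :
    fderiv ℝ (fun w : ℂ => (ofPlane w : E3)) 0 a = !₂[2 * a.re, 2 * a.im, 0] := by
  have h0 : HasDerivAt (fun t : ℝ => t • a) a 0 := by
    simpa using (hasDerivAt_id (0 : ℝ)).smul_const a
  have h1 := HasFDerivAt.comp_hasDerivAt_of_eq (0 : ℝ) hasFDerivAt_coe_ofPlane_zero h0 (by simp)
  have key (i : Fin 3) : HasDerivAt (fun t : ℝ => (ofPlane (t • a) : E3) i)
      ((fderiv ℝ (fun w : ℂ => (ofPlane w : E3)) 0 a) i) 0 :=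
    ((EuclideanSpace.proj (𝕜 := ℝ) i).hasFDerivAt).comp_hasDerivAt (0 : ℝ) h1
  have hl (c : ℝ) : HasDerivAt (fun t : ℝ => t * c) c 0 := hasDerivAt_mul_const c
  have hs (c : ℝ) : HasDerivAt (fun t : ℝ => (t * c) ^ 2) 0 0 := by
    simpa using (hl c).fun_pow 2
  have hq := (hs a.re).fun_add (hs a.im)
  ext i
  refine (key i).unique ?_
  simp only [ofPlane_coe, Complex.smul_re, Complex.smul_im, smul_eq_mul]
  fin_cases i
  · simpa using ((hl a.re).const_mul 2).fun_div (hq.add_const 1) (by simp)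
  · simpa using ((hl a.im).const_mul 2).fun_div (hq.add_const 1) (by simp)
  · simpa using (hq.sub_const 1).fun_div (hq.add_const 1) (by simp)

/-- The differential at the south pole of an orientation preserving diffeomorphism that fixes the
south pole has positive determinant. -/
lemma det_fderiv_planeMap_pos {g : Equiv.Perm S2} (hg : g ∈ DiffOne)
    (h0 : g (ofPlane 0) = ofPlane 0) :
    0 < (fderiv ℝ (planeMap g) 0 1).re * (fderiv ℝ (planeMap g) 0 Complex.I).im -
      (fderiv ℝ (planeMap g) 0 1).im * (fderiv ℝ (planeMap g) 0 Complex.I).re := by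
  have hN : g (ofPlane 0) ≠ north := by rw [h0]; exact ofPlane_ne_north 0
  have hz : planeMap g 0 = 0 := by rw [planeMap, h0, toPlane_ofPlane]
  have heq : (fun w => (g (ofPlane w) : E3)) =ᶠ[𝓝 0]
      (fun w => (ofPlane w : E3)) ∘ planeMap g := by
    filter_upwards [eventually_ne_north hg hN] with w hw
    rw [Function.comp_apply, ofPlane_planeMap hw]
  have hd : fderiv ℝ (fun w => (g (ofPlane w) : E3)) 0
      = (fderiv ℝ (fun w => (ofPlane w : E3)) 0).comp (fderiv ℝ (planeMap g) 0) := by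
    rw [heq.fderiv_eq]
    have h1 := hasFDerivAt_coe_ofPlane_zero
    nth_rw 2 [← hz] at h1
    exact (h1.comp (0 : ℂ) (differentiableAt_planeMap hg hN).hasFDerivAt).fderiv
  have hp : ((ofPlane 0 : S2) : E3) = !₂[0, 0, -1] := by
    rw [ofPlane_coe]; simp
  have hid (a : ℂ) : ambientDeriv id (ofPlane 0) (mfderiv 𝓘(ℝ, ℂ) (𝓡 2) ofPlane 0 a)
      = !₂[2 * a.re, 2 * a.im, 0] := by
    rw [← fderiv_coe_ofPlane_zero]
    exact ambientDeriv_mfderiv one_mem_DiffOne 0 a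
  -- The frame is `(i, 1)`, not `(1, i)`: the outward normal at the south pole points down, so this
  -- order is the positive one.
  have := hg.2.2 (ofPlane 0) (mfderiv 𝓘(ℝ, ℂ) (𝓡 2) ofPlane 0 Complex.I)
    (mfderiv 𝓘(ℝ, ℂ) (𝓡 2) ofPlane 0 (1 : ℂ))
  rw [hid, hid, ambientDeriv_mfderiv hg, ambientDeriv_mfderiv hg, hd, h0, hp,
    ContinuousLinearMap.comp_apply, ContinuousLinearMap.comp_apply, fderiv_coe_ofPlane_zero,
    fderiv_coe_ofPlane_zero] at this
  simp [vol, Matrix.det_fin_three] at this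
  linarith


/-! ### Groups of diffeomorphisms that contain the rotations and are sharply 3-transitive -/

/-- A sharply 3-transitive group of diffeomorphisms of the sphere that contains the rotations. -/
structure IsSharpDiffGroup (G : Subgroup (Equiv.Perm S2)) : Prop where
  subset_diffOne : (G : Set (Equiv.Perm S2)) ⊆ DiffOne
  rot_subset : Rot ⊆ (G : Set (Equiv.Perm S2))
  sharplyTransitive : SharplyTransitive 3 G

/-- The transformation fixes the two poles. -/
def FixesPoles (g : Equiv.Perm S2) : Prop := g north = north ∧ g (ofPlane 0) = ofPlane 0

namespace FixesPoles

variable {g h : Equiv.Perm S2}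

lemma mul (hg : FixesPoles g) (hh : FixesPoles h) : FixesPoles (g * h) :=
  ⟨by rw [Equiv.Perm.mul_apply, hh.1, hg.1], by rw [Equiv.Perm.mul_apply, hh.2, hg.2]⟩

lemma inv (hg : FixesPoles g) : FixesPoles g⁻¹ :=
  ⟨Equiv.Perm.inv_eq_iff_eq.2 hg.1.symm, Equiv.Perm.inv_eq_iff_eq.2 hg.2.symm⟩

lemma ne_north (hg : FixesPoles g) (w : ℂ) : g (ofPlane w) ≠ north := fun e =>
  ofPlane_ne_north w (g.injective (e.trans hg.1.symm))

lemma apply_ofPlane (hg : FixesPoles g) (w : ℂ) : g (ofPlane w) = ofPlane (planeMap g w) :=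
  (ofPlane_planeMap (hg.ne_north w)).symm

lemma planeMap_ne_zero (hg : FixesPoles g) {w : ℂ} (hw : w ≠ 0) : planeMap g w ≠ 0 := by
  intro e
  have := hg.apply_ofPlane w
  rw [e, ← hg.2] at this
  exact hw (ofPlane_injective (g.injective this))

lemma differentiable (hg : FixesPoles g) (hd : g ∈ DiffOne) : Differentiable ℝ (planeMap g) :=
  fun w => differentiableAt_planeMap hd (hg.ne_north w)

end FixesPoles

lemma fixesPoles_dilation (x : ℂ) (hx : x ≠ 0) : FixesPoles (mobius (dilation x hx)) :=
  ⟨mobius_dilation_north x hx, by rw [mobius_dilation_ofPlane, mul_zero]⟩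

lemma planeMap_dilation (x : ℂ) (hx : x ≠ 0) (w : ℂ) :
    planeMap (mobius (dilation x hx)) w = x ^ 2 * w := by
  rw [planeMap, mobius_dilation_ofPlane, toPlane_ofPlane]

lemma exists_sq_eq {c : ℂ} (hc : c ≠ 0) : ∃ x : ℂ, x ≠ 0 ∧ x ^ 2 = c := by
  obtain ⟨x, hx⟩ := IsAlgClosed.exists_pow_nat_eq c (n := 2) (by norm_num)
  exact ⟨x, by rintro rfl; exact hc (by rw [← hx]; norm_num), hx⟩

namespace IsSharpDiffGroup

variable {G : Subgroup (Equiv.Perm S2)}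

lemma diffOne (hG : IsSharpDiffGroup G) {g : Equiv.Perm S2} (hg : g ∈ G) : g ∈ DiffOne :=
  hG.subset_diffOne hg

lemma exists_map_triple (hG : IsSharpDiffGroup G) {p₁ p₂ p₃ q₁ q₂ q₃ : S2}
    (hp : p₁ ≠ p₂ ∧ p₁ ≠ p₃ ∧ p₂ ≠ p₃) (hq : q₁ ≠ q₂ ∧ q₁ ≠ q₃ ∧ q₂ ≠ q₃) :
    ∃ g ∈ G, g p₁ = q₁ ∧ g p₂ = q₂ ∧ g p₃ = q₃ := by
  have inj {a b c : S2} (h : a ≠ b ∧ a ≠ c ∧ b ≠ c) : Function.Injective ![a, b, c] := by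
    obtain ⟨h1, h2, h3⟩ := h
    intro i j hij
    fin_cases i <;> fin_cases j <;> simp_all
  obtain ⟨g, hg⟩ := hG.sharplyTransitive.1.exists_smul_eq ⟨_, inj hp⟩ ⟨_, inj hq⟩
  have h (i : Fin 3) := DFunLike.congr_fun hg i
  exact ⟨g, g.2, h 0, h 1, h 2⟩

lemma eq_of_fixesPoles (hG : IsSharpDiffGroup G) {g h : Equiv.Perm S2} (hg : g ∈ G) (hh : h ∈ G)
    (fg : FixesPoles g) (fh : FixesPoles h) {z : ℂ} (hz : z ≠ 0)
    (e : planeMap g z = planeMap h z) : g = h := by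
  have f := fh.inv.mul fg
  have inj : Function.Injective ![north, ofPlane 0, ofPlane z] := by
    have h0 := ofPlane_ne_north 0
    have h1 := ofPlane_ne_north z
    have h2 : ofPlane z ≠ ofPlane 0 := ofPlane_injective.ne hz
    intro i j hij
    fin_cases i <;> fin_cases j <;> simp_all [eq_comm]
  have hz' : (h⁻¹ * g) (ofPlane z) = ofPlane z := by
    rw [Equiv.Perm.mul_apply, Equiv.Perm.inv_eq_iff_eq, fg.apply_ofPlane, fh.apply_ofPlane, e]
  have := hG.sharplyTransitive.2 ⟨_, inj⟩ _ (G.mul_mem (G.inv_mem hh) hg) (by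
    intro i
    fin_cases i
    · exact f.1
    · exact f.2
    · exact hz')
  exact (inv_mul_eq_one.1 this).symm

lemma unitaryMatrix_mem (hG : IsSharpDiffGroup G) {a b : ℂ} (h : a * conj a + b * conj b = 1) :
    mobius (unitaryMatrix a b h) ∈ G := hG.rot_subset (mobius_unitaryMatrix_mem_Rot h)

lemma dilation_mem_of_norm_eq_one (hG : IsSharpDiffGroup G) {x : ℂ} (hx : x ≠ 0) (h : ‖x‖ = 1) :
    mobius (dilation x hx) ∈ G := by
  have h1 : x * conj x = 1 := by rw [Complex.mul_conj, Complex.normSq_eq_norm_sq, h]; simp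
  have h2 : dilation x hx = unitaryMatrix x 0 (by simp [h1]) := by
    ext i j
    fin_cases i <;> fin_cases j <;> simp [dilation, unitaryMatrix, inv_eq_of_mul_eq_one_right h1]
  rw [h2]
  exact hG.unitaryMatrix_mem _

lemma exists_unit_dilation (hG : IsSharpDiffGroup G) {c : ℂ} (hc : ‖c‖ = 1) :
    ∃ r ∈ G, FixesPoles r ∧ ∀ w, planeMap r w = c * w := by
  obtain ⟨x, hx, rfl⟩ := exists_sq_eq (c := c) (by rintro rfl; simp at hc)
  have : ‖x‖ = 1 := by
    rw [norm_pow] at hc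
    exact (pow_eq_one_iff_of_nonneg (norm_nonneg x) two_ne_zero).1 hc
  exact ⟨_, hG.dilation_mem_of_norm_eq_one hx this, fixesPoles_dilation x hx,
    planeMap_dilation x hx⟩

/-- The axial rotation by `planeMap k z / z` lies in `G` and agrees with `k` at the poles and at
`z`, so sharpness identifies the two. -/
lemma exists_mul_of_norm_eq (hG : IsSharpDiffGroup G) {k : Equiv.Perm S2} (hk : k ∈ G)
    (fk : FixesPoles k) {z : ℂ} (hz : z ≠ 0) (h : ‖planeMap k z‖ = ‖z‖) :
    ∃ c : ℂ, ∀ w, planeMap k w = c * w := by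
  obtain ⟨r, hr, fr, er⟩ := hG.exists_unit_dilation (c := planeMap k z / z) (by
    rw [norm_div, h, div_self (by simpa using hz)])
  refine ⟨planeMap k z / z, fun w => ?_⟩
  have e := hG.eq_of_fixesPoles hk hr fk fr hz (by rw [er, div_mul_cancel₀ _ hz])
  exact (congrArg (fun q => planeMap q w) e).trans (er w)

/-- An element that fixes the poles maps circles around the axis to circles around the axis: it
conjugates rotations around the axis to such rotations. -/
lemma exists_planeMap_mul_eq (hG : IsSharpDiffGroup G) {h : Equiv.Perm S2} (hh : h ∈ G)
    (fh : FixesPoles h) {c : ℂ} (hc : ‖c‖ = 1) :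
    ∃ d : ℂ, ∀ w, planeMap h (c * w) = d * planeMap h w := by
  have hcont : Continuous (planeMap h) := (fh.differentiable (hG.diffOne hh)).continuous
  obtain ⟨r, hr, fr, er⟩ := hG.exists_unit_dilation hc
  have hS : IsPreconnected (Metric.sphere (0 : ℂ) 1) :=
    isPreconnected_sphere (by rw [Complex.rank_real_complex]; norm_num) 0 1
  have hK : IsCompact (Metric.sphere (0 : ℂ) 1) := isCompact_sphere 0 1
  have hne : (Metric.sphere (0 : ℂ) 1).Nonempty := ⟨1, by simp⟩
  have hmul {w : ℂ} (hw : w ∈ Metric.sphere (0 : ℂ) 1) : c * w ∈ Metric.sphere (0 : ℂ) 1 := by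
    simp_all
  obtain ⟨w₀, h₀, hmax⟩ := hK.exists_isMaxOn hne hcont.norm.continuousOn
  obtain ⟨w₁, h₁, hmin⟩ := hK.exists_isMinOn hne hcont.norm.continuousOn
  -- Rotating by `c` cannot increase the modulus at a maximum nor decrease it at a minimum;
  -- connectedness of the circle gives a point where it is unchanged.
  obtain ⟨w, hw, ew⟩ := hS.intermediate_value₂ h₀ h₁
    (hcont.comp (continuous_const.mul continuous_id)).norm.continuousOn hcont.norm.continuousOn
    (hmax (hmul h₀)) (hmin (hmul h₁))
  have hw0 : w ≠ 0 := by rintro rfl; simp at hw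
  have fk := (fh.mul fr).mul fh.inv
  have key (v : ℂ) : planeMap (h * r * h⁻¹) (planeMap h v) = planeMap h (c * v) := by
    apply ofPlane_injective
    rw [← fk.apply_ofPlane, ← fh.apply_ofPlane, Equiv.Perm.mul_apply,
      show h⁻¹ (h (ofPlane v)) = ofPlane v from h.symm_apply_apply _, Equiv.Perm.mul_apply,
      fr.apply_ofPlane, er, fh.apply_ofPlane]
  obtain ⟨d, hd⟩ := hG.exists_mul_of_norm_eq (G.mul_mem (G.mul_mem hh hr) (G.inv_mem hh)) fk
    (fh.planeMap_ne_zero hw0) (by rw [key]; exact ew)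
  exact ⟨d, fun v => by rw [← key, hd]⟩

/-- An element that fixes the poles is conformal at the south pole and commutes with the rotations
around the axis. -/
lemma fderiv_planeMap_zero_I (hG : IsSharpDiffGroup G) {h : Equiv.Perm S2} (hh : h ∈ G)
    (fh : FixesPoles h) :
    fderiv ℝ (planeMap h) 0 Complex.I = Complex.I * fderiv ℝ (planeMap h) 0 1 ∧
      ∀ c : ℂ, ‖c‖ = 1 → ∀ w, planeMap h (c * w) = c * planeMap h w := by
  have hd := (fh.differentiable (hG.diffOne hh)) 0
  set D := fderiv ℝ (planeMap h) 0 with hD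
  have key {c d : ℂ} (e : ∀ w, planeMap h (c * w) = d * planeMap h w) (a : ℂ) :
      D (c * a) = d * D a := by
    have h1 : HasFDerivAt (fun w => planeMap h (c * w))
        (D.comp (ContinuousLinearMap.mul ℝ ℂ c)) 0 := by
      have h2 : HasFDerivAt (planeMap h) D (ContinuousLinearMap.mul ℝ ℂ c 0) := by
        rw [map_zero]; exact hd.hasFDerivAt
      exact h2.comp (0 : ℂ) (ContinuousLinearMap.mul ℝ ℂ c).hasFDerivAt
    have h3 : HasFDerivAt (fun w => d * planeMap h w)
        ((ContinuousLinearMap.mul ℝ ℂ d).comp D) 0 :=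
      (ContinuousLinearMap.mul ℝ ℂ d).hasFDerivAt.comp (0 : ℂ) hd.hasFDerivAt
    simp only [e] at h1
    exact congrArg (fun L => L a) (h1.unique h3)
  have hpos := det_fderiv_planeMap_pos (hG.diffOne hh) fh.2
  rw [← hD] at hpos
  have h1 : D 1 ≠ 0 := by
    intro e
    simp [e] at hpos
  -- Applying the equivariance for `c = i` twice gives `d ^ 2 = -1`; the root `d = -i` would make
  -- the determinant negative.
  have hI : D Complex.I = Complex.I * D 1 := by
    obtain ⟨d, e⟩ := hG.exists_planeMap_mul_eq hh fh (c := Complex.I) (by simp)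
    have e1 := key e 1
    have e2 := key e Complex.I
    rw [mul_one] at e1
    rw [Complex.I_mul_I, map_neg, e1] at e2
    have e3 : (d - Complex.I) * (d + Complex.I) = 0 := by
      have : (d - Complex.I) * (d + Complex.I) * D 1 = 0 := by
        linear_combination -e2 - Complex.I_mul_I * D 1
      simpa [h1] using this
    rcases mul_eq_zero.1 e3 with e4 | e4
    · rw [e1, sub_eq_zero.1 e4]
    · rw [e1, eq_neg_of_add_eq_zero_left e4] at hpos
      simp at hpos
      nlinarith [sq_nonneg (D 1).re, sq_nonneg (D 1).im]
  refine ⟨hI, fun c hc w => ?_⟩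
  obtain ⟨d, e⟩ := hG.exists_planeMap_mul_eq hh fh hc
  have e1 := key e 1
  have e2 : D c = c * D 1 := by
    conv_lhs => rw [← Complex.re_add_im c, map_add]
    have r1 : D (c.re : ℂ) = c.re * D 1 := by simpa using D.map_smul c.re 1
    have r2 : D (c.im * Complex.I) = c.im * D Complex.I := by simpa using D.map_smul c.im Complex.I
    rw [r1, r2, hI]
    conv_rhs => rw [← Complex.re_add_im c]
    ring
  rw [mul_one, e2] at e1
  rw [e, mul_right_cancel₀ h1 e1]

end IsSharpDiffGroup


/-! ### Conformality -/

lemma fderiv_planeMap_mul {g h : Equiv.Perm S2} (hg : g ∈ DiffOne) (hh : h ∈ DiffOne)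
    (g0 : g (ofPlane 0) = ofPlane 0) (h0 : h (ofPlane 0) = ofPlane 0) (a : ℂ) :
    fderiv ℝ (planeMap (g * h)) 0 a = fderiv ℝ (planeMap g) 0 (fderiv ℝ (planeMap h) 0 a) := by
  have hN : h (ofPlane 0) ≠ north := by rw [h0]; exact ofPlane_ne_north 0
  have gN : g (ofPlane 0) ≠ north := by rw [g0]; exact ofPlane_ne_north 0
  have hz : planeMap h 0 = 0 := by rw [planeMap, h0, toPlane_ofPlane]
  have h1 : HasFDerivAt (planeMap g) (fderiv ℝ (planeMap g) 0) (planeMap h 0) := by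
    rw [hz]; exact (differentiableAt_planeMap hg gN).hasFDerivAt
  rw [(planeMap_mul_eventuallyEq hh hN).fderiv_eq,
    (h1.comp (0 : ℂ) (differentiableAt_planeMap hh hN).hasFDerivAt).fderiv]
  rfl

lemma fderiv_planeMap_of_eq_mul {r : Equiv.Perm S2} {c : ℂ} (er : ∀ w, planeMap r w = c * w)
    (a : ℂ) : fderiv ℝ (planeMap r) 0 a = c * a := by
  rw [show planeMap r = ContinuousLinearMap.mul ℝ ℂ c from funext er,
    ContinuousLinearMap.fderiv]
  rfl

lemma planeMap_mobius {A : SL(2, ℂ)} {w : ℂ} (h : A 1 0 * w + A 1 1 ≠ 0) :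
    planeMap (mobius A) w = (A 0 0 * w + A 0 1) / (A 1 0 * w + A 1 1) := by
  rw [planeMap, mobius_ofPlane, if_neg h, toPlane_ofPlane]

lemma differentiableAt_planeMap_mobius {A : SL(2, ℂ)} {w : ℂ}
    (h : mobius A (ofPlane w) ≠ north) : DifferentiableAt ℂ (planeMap (mobius A)) w := by
  have hw : A 1 0 * w + A 1 1 ≠ 0 := fun e => h (by rw [mobius_ofPlane, if_pos e])
  have hc : Continuous fun z : ℂ => A 1 0 * z + A 1 1 := by fun_prop
  have he : planeMap (mobius A) =ᶠ[𝓝 w]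
      fun z => (A 0 0 * z + A 0 1) / (A 1 0 * z + A 1 1) := by
    filter_upwards [hc.continuousAt.eventually_ne hw] with z hz using planeMap_mobius hz
  refine DifferentiableAt.congr_of_eventuallyEq ?_ he
  exact DifferentiableAt.div (by fun_prop) (by fun_prop) hw

lemma differentiableAt_planeMap_mul {g h : Equiv.Perm S2} (hh : h ∈ DiffOne) {w : ℂ}
    (hw : h (ofPlane w) ≠ north) (dg : DifferentiableAt ℂ (planeMap g) (planeMap h w))
    (dh : DifferentiableAt ℂ (planeMap h) w) : DifferentiableAt ℂ (planeMap (g * h)) w :=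
  (dg.comp w dh).congr_of_eventuallyEq (planeMap_mul_eventuallyEq hh hw)

/-- A complex differentiable map of the plane that commutes with the rotations is linear. -/
lemma eq_mul_of_commutes_rotations {f : ℂ → ℂ} (hf : ∀ z ≠ 0, DifferentiableAt ℂ f z)
    (hrot : ∀ c : ℂ, ‖c‖ = 1 → ∀ z, f (c * z) = c * f z) {z : ℂ} (hz : z ≠ 0) :
    f z = f 1 * z := by
  -- Differentiate `f (exp (i t) z) = exp (i t) f z` at `t = 0`. The Euler equation obtained says
  -- that `f z / z` has zero derivative.
  have hd (z : ℂ) (hz : z ≠ 0) : deriv f z * z = f z := by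
    have h0 : HasDerivAt (fun t : ℝ => Complex.exp (t * Complex.I)) Complex.I 0 := by
      have h1 : HasDerivAt (fun t : ℝ => (t : ℂ) * Complex.I) Complex.I 0 := by
        simpa using (Complex.ofRealCLM.hasDerivAt (x := (0 : ℝ))).mul_const Complex.I
      simpa using h1.cexp
    have h2 := (hf z hz).hasDerivAt.hasFDerivAt
    have h3 := HasFDerivAt.comp_hasDerivAt_of_eq (0 : ℝ) (h2.restrictScalars ℝ)
      (h0.mul_const z) (by simp)
    have h4 : HasDerivAt (fun t : ℝ => Complex.exp (t * Complex.I) * f z) (Complex.I * f z) 0 :=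
      h0.mul_const (f z)
    have h5 : (f ∘ fun t : ℝ => Complex.exp (t * Complex.I) * z)
        = fun t : ℝ => Complex.exp (t * Complex.I) * f z :=
      funext fun t => hrot _ (Complex.norm_exp_ofReal_mul_I t) z
    rw [h5] at h3
    have h6 := h3.unique h4
    simp at h6
    have h7 : Complex.I * (deriv f z * z - f z) = 0 := by linear_combination h6
    simpa [sub_eq_zero] using h7
  have hconn : IsPreconnected ({0}ᶜ : Set ℂ) :=
    (isConnected_compl_singleton_of_one_lt_rank
      (by rw [Complex.rank_real_complex]; norm_num) 0).isPreconnected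
  have hq (w : ℂ) (hw : w ∈ ({0}ᶜ : Set ℂ)) : HasDerivAt (fun w => f w / w) 0 w := by
    have hw : w ≠ 0 := hw
    have := (hf w hw).hasDerivAt.fun_div (hasDerivAt_id' w) hw
    rwa [hd w hw, mul_one, sub_self, zero_div] at this
  have := isOpen_compl_singleton.is_const_of_deriv_eq_zero hconn
    (fun w hw => (hq w hw).differentiableAt.differentiableWithinAt)
    (fun w hw => (hq w hw).deriv) (x := z) (y := 1) hz (by simp)
  simp only [div_one] at this
  rw [← this, div_mul_cancel₀ _ hz]

namespace IsSharpDiffGroup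

variable {G : Subgroup (Equiv.Perm S2)}

/-- An element that fixes the south pole is conformal there: the group of these elements is
generated by the elements that fix both poles and by elements with trivial differential, products of
two involutions. -/
lemma fderiv_planeMap_I (hG : IsSharpDiffGroup G) {g : Equiv.Perm S2} (hg : g ∈ G)
    (g0 : g (ofPlane 0) = ofPlane 0) :
    fderiv ℝ (planeMap g) 0 Complex.I = Complex.I * fderiv ℝ (planeMap g) 0 1 := by
  by_cases hN : g north = north
  · exact (hG.fderiv_planeMap_zero_I hg ⟨hN, g0⟩).1
  have hS : g north ≠ ofPlane 0 := fun e =>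
    (ofPlane_ne_north 0).symm (g.injective (e.trans g0.symm))
  -- The half-turn `r` swaps `1` and `-1`, so `k r k⁻¹` sends `∞` to `g ∞` and fixes `0`. The
  -- further factor `r` in `t` only corrects the differential.
  obtain ⟨k, hk, k0, k1, k2⟩ := hG.exists_map_triple
    (p₁ := ofPlane 0) (p₂ := ofPlane 1) (p₃ := ofPlane (-1))
    (q₁ := ofPlane 0) (q₂ := north) (q₃ := g north)
    ⟨ofPlane_injective.ne (by norm_num), ofPlane_injective.ne (by norm_num),
      ofPlane_injective.ne (by norm_num)⟩
    ⟨ofPlane_ne_north 0, hS.symm, Ne.symm hN⟩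
  obtain ⟨r, hr, fr, er⟩ := hG.exists_unit_dilation (c := -1) (by simp)
  have k0' : k⁻¹ (ofPlane 0) = ofPlane 0 := Equiv.Perm.inv_eq_iff_eq.2 k0.symm
  have k1' : k⁻¹ north = ofPlane 1 := Equiv.Perm.inv_eq_iff_eq.2 k1.symm
  have hk' := G.inv_mem hk
  set t := k * (r * (k⁻¹ * r)) with ht
  have mt : t ∈ G := G.mul_mem hk (G.mul_mem hr (G.mul_mem hk' hr))
  have t0 : t (ofPlane 0) = ofPlane 0 := by
    simp only [ht, Equiv.Perm.mul_apply, fr.2, k0', k0]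
  have tN : t north = g north := by
    simp only [ht, Equiv.Perm.mul_apply, fr.1, k1', fr.apply_ofPlane, er, mul_one, k2]
  -- The half-turn has differential `-1` at `0`, which is central, so its conjugate has it too and
  -- the two signs cancel.
  have dt (a : ℂ) : fderiv ℝ (planeMap t) 0 a = a := by
    have e1 : (r * (k⁻¹ * r)) (ofPlane 0) = ofPlane 0 := by
      simp only [Equiv.Perm.mul_apply, fr.2, k0']
    have e2 : (k⁻¹ * r) (ofPlane 0) = ofPlane 0 := by
      simp only [Equiv.Perm.mul_apply, fr.2, k0']
    have e3 := fderiv_planeMap_mul (hG.diffOne hk) (hG.diffOne hk') k0 k0' a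
    have e4 : fderiv ℝ (planeMap (k * k⁻¹)) 0 a = a := by
      rw [fderiv_planeMap_of_eq_mul (c := 1) (fun w => by
        rw [mul_inv_cancel, planeMap, Equiv.Perm.one_apply, toPlane_ofPlane, one_mul]), one_mul]
    rw [ht, fderiv_planeMap_mul (hG.diffOne hk)
        (hG.diffOne (G.mul_mem hr (G.mul_mem hk' hr))) k0 e1,
      fderiv_planeMap_mul (hG.diffOne hr) (hG.diffOne (G.mul_mem hk' hr)) fr.2 e2,
      fderiv_planeMap_mul (hG.diffOne hk') (hG.diffOne hr) k0' fr.2,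
      fderiv_planeMap_of_eq_mul er, fderiv_planeMap_of_eq_mul er]
    simp only [neg_mul, one_mul, map_neg, neg_neg]
    rw [← e3, e4]
  have mh : t⁻¹ * g ∈ G := G.mul_mem (G.inv_mem mt) hg
  have fh : FixesPoles (t⁻¹ * g) := by
    constructor
    · rw [Equiv.Perm.mul_apply, ← tN]; exact t.symm_apply_apply _
    · rw [Equiv.Perm.mul_apply, g0, Equiv.Perm.inv_eq_iff_eq, t0]
  have hgt (a : ℂ) : fderiv ℝ (planeMap g) 0 a = fderiv ℝ (planeMap (t⁻¹ * g)) 0 a := by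
    conv_lhs => rw [← mul_inv_cancel_left t g]
    rw [fderiv_planeMap_mul (hG.diffOne mt) (hG.diffOne mh) t0 fh.2, dt]
  rw [hgt, hgt, (hG.fderiv_planeMap_zero_I mh fh).1]

/-! ### Holomorphy on the whole plane. -/

lemma differentiableAt_complex_zero (hG : IsSharpDiffGroup G) {g : Equiv.Perm S2} (hg : g ∈ G)
    (g0 : g (ofPlane 0) = ofPlane 0) : DifferentiableAt ℂ (planeMap g) 0 :=
  differentiableAt_complex_iff_differentiableAt_real.2
    ⟨differentiableAt_planeMap (hG.diffOne hg) (by rw [g0]; exact ofPlane_ne_north 0),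
      by rw [hG.fderiv_planeMap_I hg g0, smul_eq_mul]⟩

/-- The matrix of `SU(2)` with first row proportional to `(1, z)` sends `0` to `z`. -/
lemma exists_rotation (hG : IsSharpDiffGroup G) (z : ℂ) :
    ∃ A : SL(2, ℂ), mobius A ∈ G ∧ mobius A (ofPlane 0) = ofPlane z := by
  have hs : 0 < 1 + Complex.normSq z := by linarith [Complex.normSq_nonneg z]
  set s := √(1 + Complex.normSq z) with hs'
  have h1 : s ≠ 0 := (Real.sqrt_pos.2 hs).ne'
  have h2 : s ^ 2 = 1 + Complex.normSq z := Real.sq_sqrt hs.le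
  have h1' : (s : ℂ) ≠ 0 := by exact_mod_cast h1
  have h2' : (s : ℂ) ^ 2 = 1 + z * conj z := by rw [Complex.mul_conj]; exact_mod_cast h2
  have h : (s : ℂ)⁻¹ * conj (s : ℂ)⁻¹ + z / s * conj (z / s) = 1 := by
    simp only [map_inv₀, map_div₀, Complex.conj_ofReal]
    field_simp
    rw [h2']
  refine ⟨_, hG.unitaryMatrix_mem h, ?_⟩
  rw [mobius_ofPlane]
  simp [unitaryMatrix, h1']

/-- Rotations taking `0` to `z` and to the image of `z` turn `h` into an element of `G` fixing `0`,
which is conformal there; the rotations themselves are holomorphic. -/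
lemma differentiableAt_complex (hG : IsSharpDiffGroup G) {h : Equiv.Perm S2} (hh : h ∈ G)
    (fh : FixesPoles h) (z : ℂ) : DifferentiableAt ℂ (planeMap h) z := by
  obtain ⟨A, hA, eA⟩ := hG.exists_rotation z
  obtain ⟨B, hB, eB⟩ := hG.exists_rotation (planeMap h z)
  have hA' := G.inv_mem hA
  have eA' : (mobius A)⁻¹ (ofPlane z) = ofPlane 0 := Equiv.Perm.inv_eq_iff_eq.2 eA.symm
  set g := (mobius B)⁻¹ * h * mobius A with hg
  have mg : g ∈ G := G.mul_mem (G.mul_mem (G.inv_mem hB) hh) hA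
  have g0 : g (ofPlane 0) = ofPlane 0 := by
    rw [hg, Equiv.Perm.mul_apply, Equiv.Perm.mul_apply, eA, fh.apply_ofPlane,
      Equiv.Perm.inv_eq_iff_eq, eB]
  have e : h = mobius B * (g * (mobius A)⁻¹) := by rw [hg]; group
  have pA : planeMap (mobius A)⁻¹ z = 0 := by rw [planeMap, eA', toPlane_ofPlane]
  have e1 : (g * (mobius A)⁻¹) (ofPlane z) = ofPlane 0 := by
    rw [Equiv.Perm.mul_apply, eA', g0]
  have p1 : planeMap (g * (mobius A)⁻¹) z = 0 := by rw [planeMap, e1, toPlane_ofPlane]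
  rw [e]
  refine differentiableAt_planeMap_mul (hG.diffOne (G.mul_mem mg hA'))
    (by rw [e1]; exact ofPlane_ne_north 0) ?_
    (differentiableAt_planeMap_mul (hG.diffOne hA') (by rw [eA']; exact ofPlane_ne_north 0) ?_ ?_)
  · rw [p1]
    exact differentiableAt_planeMap_mobius (by rw [eB]; exact ofPlane_ne_north _)
  · rw [pA]
    exact hG.differentiableAt_complex_zero mg g0
  · rw [← map_inv] at eA' ⊢
    exact differentiableAt_planeMap_mobius (by rw [eA']; exact ofPlane_ne_north 0)

lemma exists_eq_mobius_dilation (hG : IsSharpDiffGroup G) {h : Equiv.Perm S2} (hh : h ∈ G)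
    (fh : FixesPoles h) :
    ∃ (x : ℂ) (hx : x ≠ 0), x ^ 2 = planeMap h 1 ∧ h = mobius (dilation x hx) := by
  obtain ⟨x, hx, ex⟩ := exists_sq_eq (fh.planeMap_ne_zero one_ne_zero)
  refine ⟨x, hx, ex, ?_⟩
  have fd := fixesPoles_dilation x hx
  ext1 p
  obtain rfl | ⟨w, rfl⟩ := eq_north_or_ofPlane p
  · rw [fh.1, fd.1]
  · by_cases hw : w = 0
    · rw [hw, fh.2, fd.2]
    · rw [fh.apply_ofPlane, mobius_dilation_ofPlane, ex, eq_mul_of_commutes_rotations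
        (fun z _ => hG.differentiableAt_complex hh fh z) (hG.fderiv_planeMap_zero_I hh fh).2 hw]

/-! ### Generation of the Möbius group. -/

lemma dilation_mem (hG : IsSharpDiffGroup G) (x : ℂ) (hx : x ≠ 0) :
    mobius (dilation x hx) ∈ G := by
  have h (z : ℂ) (hz : z ≠ 0) :
      ofPlane 0 ≠ north ∧ ofPlane 0 ≠ ofPlane z ∧ north ≠ ofPlane z :=
    ⟨ofPlane_ne_north 0, ofPlane_injective.ne hz.symm, (ofPlane_ne_north z).symm⟩
  obtain ⟨g, hg, g0, gN, g1⟩ :=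
    hG.exists_map_triple (h 1 one_ne_zero) (h (x ^ 2) (pow_ne_zero 2 hx))
  -- Possibly `y = -x`, which is harmless: a dilation acts through the square of its parameter.
  obtain ⟨y, hy, ey, rfl⟩ := hG.exists_eq_mobius_dilation hg ⟨gN, g0⟩
  rw [planeMap, g1, toPlane_ofPlane] at ey
  convert hg using 1
  ext1 p
  obtain rfl | ⟨w, rfl⟩ := eq_north_or_ofPlane p
  · rw [mobius_dilation_north, mobius_dilation_north]
  · rw [mobius_dilation_ofPlane, mobius_dilation_ofPlane, ey]

lemma translation_mem (hG : IsSharpDiffGroup G) (b : ℂ) : mobius (translation b) ∈ G := by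
  -- A singular value decomposition of one translation, made rational by the 3-4-5 triangle: the
  -- singular values are `4/3` and `3/4`, and `7/12` is their difference. Conjugating by dilations
  -- then yields every nonzero translation.
  have h1 : mobius (translation (-7 / 12)) ∈ G := by
    have e1 : (4 / 5 : ℂ) * conj (4 / 5 : ℂ) + 3 / 5 * conj (3 / 5 : ℂ) = 1 := by
      simp only [map_div₀, map_ofNat]; norm_num
    have e2 : (3 / 5 : ℂ) * conj (3 / 5 : ℂ) + -4 / 5 * conj (-4 / 5 : ℂ) = 1 := by
      simp only [map_div₀, map_neg, map_ofNat]; norm_num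
    have e : translation (-7 / 12) = unitaryMatrix (4 / 5) (3 / 5) e1 *
        dilation (4 / 3) (by norm_num) * unitaryMatrix (3 / 5) (-4 / 5) e2 := by
      apply Subtype.ext
      simp only [Matrix.SpecialLinearGroup.coe_mul, coe_dilation, coe_translation,
        coe_unitaryMatrix, Matrix.mul_fin_two, map_div₀, map_neg, map_ofNat]
      norm_num
    rw [e, map_mul, map_mul]
    exact G.mul_mem (G.mul_mem (hG.unitaryMatrix_mem _) (hG.dilation_mem _ _))
      (hG.unitaryMatrix_mem _)
  by_cases hb : b = 0
  · have : translation b = 1 := by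
      ext i j
      fin_cases i <;> fin_cases j <;> simp [translation, hb]
    rw [this, map_one]
    exact G.one_mem
  · obtain ⟨x, hx, ex⟩ := exists_sq_eq (c := b / (-7 / 12)) (div_ne_zero hb (by norm_num))
    have e : translation b =
        dilation x hx * translation (-7 / 12) * dilation x⁻¹ (inv_ne_zero hx) := by
      have : x * (-7 / 12) * x = b := by
        rw [mul_right_comm, ← pow_two, ex, div_mul_cancel₀ _ (by norm_num)]
      apply Subtype.ext
      simp only [Matrix.SpecialLinearGroup.coe_mul, coe_dilation, coe_translation,
        Matrix.mul_fin_two]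
      simp [hx, this]
    rw [e, map_mul, map_mul]
    exact G.mul_mem (G.mul_mem (hG.dilation_mem _ _) h1) (hG.dilation_mem _ _)

/-- Bruhat decomposition: `A` is upper triangular, or a product of translations, a dilation and the
Weyl element, which is unitary. -/
lemma mobius_mem (hG : IsSharpDiffGroup G) (A : SL(2, ℂ)) : mobius A ∈ G := by
  have hdet : A 0 0 * A 1 1 - A 0 1 * A 1 0 = 1 := by rw [← Matrix.det_fin_two]; exact A.2
  by_cases hc : A 1 0 = 0
  · rw [hc, mul_zero, sub_zero] at hdet
    have ha : A 0 0 ≠ 0 := left_ne_zero_of_mul_eq_one hdet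
    have e : A = dilation (A 0 0) ha * translation (A 0 1 / A 0 0) := by
      apply Subtype.ext
      simp only [Matrix.SpecialLinearGroup.coe_mul, coe_dilation, coe_translation,
        Matrix.mul_fin_two]
      rw [Matrix.eta_fin_two A.1]
      simp [hc, mul_div_cancel₀ _ ha, eq_inv_of_mul_eq_one_right hdet]
    rw [e, map_mul]
    exact G.mul_mem (hG.dilation_mem _ _) (hG.translation_mem _)
  · have e : A = translation (A 0 0 / A 1 0) * unitaryMatrix 0 (-1) (by simp) *
        dilation (A 1 0) hc * translation (A 1 1 / A 1 0) := by
      have hb : A 0 1 = A 0 0 / A 1 0 * A 1 0 * (A 1 1 / A 1 0) - (A 1 0)⁻¹ := by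
        field_simp
        linear_combination -hdet
      apply Subtype.ext
      simp only [Matrix.SpecialLinearGroup.coe_mul, coe_dilation, coe_translation,
        coe_unitaryMatrix, Matrix.mul_fin_two]
      rw [Matrix.eta_fin_two A.1]
      simp [hc, mul_div_cancel₀]
      simpa [hc, sub_eq_add_neg] using hb
    rw [e, map_mul, map_mul, map_mul]
    exact G.mul_mem (G.mul_mem (G.mul_mem (hG.translation_mem _) (hG.unitaryMatrix_mem _))
      (hG.dilation_mem _ _)) (hG.translation_mem _)

lemma exists_mobius_north (p : S2) : ∃ A : SL(2, ℂ), mobius A north = p := by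
  obtain rfl | ⟨w, rfl⟩ := eq_north_or_ofPlane p
  · exact ⟨1, by rw [map_one, Equiv.Perm.one_apply]⟩
  · refine ⟨translation w * unitaryMatrix 0 (-1) (by simp), ?_⟩
    have : mobius (unitaryMatrix 0 (-1) (by simp)) north = ofPlane 0 := by
      rw [mobius_north]
      simp [unitaryMatrix]
    rw [map_mul, Equiv.Perm.mul_apply, this, mobius_translation_ofPlane, zero_add]

lemma eq_Mob (hG : IsSharpDiffGroup G) : G = Mob := by
  refine le_antisymm (fun g hg => ?_) ?_
  · obtain ⟨A, hA⟩ := exists_mobius_north (g north)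
    obtain hN | ⟨b, hb⟩ := eq_north_or_ofPlane ((mobius A)⁻¹ (g (ofPlane 0)))
    · rw [Equiv.Perm.inv_eq_iff_eq, hA] at hN
      exact absurd (g.injective hN) (ofPlane_ne_north 0)
    -- `A` matches the image of `∞` and the translation by `b` that of `0`, so what remains of `g`
    -- fixes both poles and is a dilation.
    · have f : FixesPoles ((mobius (translation b))⁻¹ * ((mobius A)⁻¹ * g)) := by
        constructor
        · rw [Equiv.Perm.mul_apply, Equiv.Perm.inv_eq_iff_eq, mobius_translation_north,
            Equiv.Perm.mul_apply, Equiv.Perm.inv_eq_iff_eq, hA]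
        · rw [Equiv.Perm.mul_apply, Equiv.Perm.inv_eq_iff_eq, mobius_translation_ofPlane,
            Equiv.Perm.mul_apply, hb, zero_add]
      obtain ⟨x, hx, -, e⟩ := hG.exists_eq_mobius_dilation
        (G.mul_mem (G.inv_mem (hG.mobius_mem _)) (G.mul_mem (G.inv_mem (hG.mobius_mem A)) hg)) f
      refine ⟨A * (translation b * dilation x hx), ?_⟩
      rw [map_mul, map_mul, ← e]
      group
  · rintro _ ⟨A, rfl⟩
    exact hG.mobius_mem A

end IsSharpDiffGroup

end SharpMobius

end

theorem theoremC (G : Subgroup (Equiv.Perm SharpMobius.S2))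
    (hDiff : (G : Set (Equiv.Perm SharpMobius.S2)) ⊆ SharpMobius.DiffOne)
    (hRot : SharpMobius.Rot ⊆ (G : Set (Equiv.Perm SharpMobius.S2)))
    (hSharp : SharpMobius.SharplyTransitive 3 G) :
    G = SharpMobius.Mob :=
  SharpMobius.IsSharpDiffGroup.eq_Mob ⟨hDiff, hRot, hSharp⟩
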